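/- **Setting.** Let $L$ be a commutative semiring, possibly without zero (an abelian additive semigroup with a commutative, unital, distributive multiplication), and let $G$ be a totally ordered abelian group, written multiplicatively. Let $R=R(L,G)=\{{}^{[\ell]}a : \ell\in L,\ a\in G\}$ be the uniform $L$-layered $1$-semifield with $${}^{[k]}a\cdot{}^{[\ell]}b={}^{[k\ell]}(ab),\qquad {}^{[k]}a+{}^{[\ell]}b=\begin{cases}{}^{[k]}a & a>b,\\ {}^{[\ell]}b & a<b,\\ {}^{[k+\ell]}a & a=b,\end{cases}$$ and adjoin a zero element $\mathbb 0$ to $R$. Put $\nu({}^{[\ell]}a)=a$ and $\nu(\mathbb 0)=0<a$ for all $a\in G$; elements are $\nu$-equivalent ($\cong_\nu$) if they have the same $\nu$-value. A polynomial over $R\cup\{\mathbb 0\}$ is *monic* if its leading coefficient is $\nu$-equivalent to $1$. For $a\in G$, a monic polynomial $f=\sum_{i=0}^{t}\alpha_i\lambda^i$ of degree $t$ is *$a$-primary* if $\alpha_0\ne\mathbb 0$ and every nonzero $\alpha_i$ satisfies $\nu(\alpha_i)=a^{t-i}$. For $f=\sum_{i=0}^m\alpha_i\lambda^i$ and $g=\sum_{j=0}^n\beta_j\lambda^j$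 of degrees $m,n$, the *layered resultant* $|\Re(f,g)|$ is the permanent of the $(m+n)\times(m+n)$ Sylvester matrix, whose first $n$ rows are the shifts of $(\alpha_0,\dots,\alpha_m)$ and whose last $m$ rows are the shifts of $(\beta_0,\dots,\beta_n)$; it equals $\alpha_0^n$ if $m=0$ and $\beta_0^m$ if $n=0$. A *primary decomposition* $f=\prod_{a\in A}f_a$ consists of a finite set $A\subset G$ and $a$-primary polynomials $f_a$ ($a\in A$) such that $f$ and $h=\prod_{a\in A} f_a$ have the same coefficients, except possibly at exponents $i$ for which the $i$-th monomial is strictly dominated everywhere both in $f$ and in $h$ (the $i$-th monomial of $p=\sum_j\gamma_j\lambda^j$ is strictly dominated everywhere if for each $x\in G$ there is $j$ with $\nu(\gamma_i)x^i<\nu(\gamma_j)x^j$). If, moreover, any two distinct elements $k,\ell$ of $L$ satisfy $\ell=k+p$ or $k=\ell+p$ for some $p\in L$, and $k+p\neq k$ for all $k,p\in L$ (for example $L=\mathbb N_{>0},\mathbb Q_{>0},\mathbb R_{>0}$), then it is also allowed that $f=\prod_{a\in A} f_a$ merely holds as an equality of functions on $R$. **Theorem.** Let $f$ and $g$ be monic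 polynomials with primary decompositions $f=\prod_{a\in A}f_a$ and $g=\prod_{b\in B}g_b$. Then $$|\Re(f,g)|=\prod_{a\in A}\prod_{b\in B}|\Re(f_a,g_b)|$$ (equality in $R$, not only $\nu$-equivalence). Moreover, for $a\in A$ and $b\in B$, with $m_a=\deg f_a$ and $n_b=\deg g_b$: if $a<b$, then $|\Re(f_a,g_b)|=\mathrm{lc}(f_a)^{n_b}\,g_b(\mathbb 0)^{m_a}$, and if $a>b$, then $|\Re(f_a,g_b)|=f_a(\mathbb 0)^{n_b}\,\mathrm{lc}(g_b)^{m_a}$, where $\mathrm{lc}$ denotes the leading coefficient and $p(\mathbb 0)$ the constant term. Thus the computation of $|\Re(f,g)|$ is reduced to the factors $|\Re(f_a,g_b)|$ with $a=b$. -/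

import Mathlib

open Polynomial

/-- A commutative semiring without (necessarily) a zero element: `(L, +)` is an abelian semigroup,
`(L, *, 1)` is an abelian monoid, and multiplication distributes over addition. -/
class CommSemiringDagger (L : Type*) extends AddCommSemigroup L, CommMonoid L where
  dagger_mul_add : ∀ a b c : L, a * (b + c) = a * b + a * c

/-- The total order and finiteness conditions on a sorting semiring all of whose elements are
positive: writing `k < l` when `l = k + p` for some `p`, any two distinct elements are comparable,
and every element `k` is finite, i.e. `k + p ≠ k` for all `p`. -/
def AllPositiveFinite (L : Type*) [CommSemiringDagger L] : Prop :=
  (∀ k l : L, k ≠ l → (∃ p, l = k + p) ∨ (∃ p, k = l + p)) ∧ ∀ k p : L, k + p ≠ k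

/-- The underlying set of the layered domain `R(L, G)`: the element with layer `l` and
`ν`-value `a`. -/
@[ext]
structure Layered (L G : Type*) where
  layer : L
  val : G

namespace Layered

variable {L G : Type*} [CommSemiringDagger L] [CommGroup G] [LinearOrder G] [IsOrderedMonoid G]

instance : Mul (Layered L G) := ⟨fun x y => ⟨x.layer * y.layer, x.val * y.val⟩⟩

instance : One (Layered L G) := ⟨⟨1, 1⟩⟩

/-- The summand with larger `ν`-value wins; layers are added when the `ν`-values agree. -/
instance : Add (Layered L G) :=
  ⟨fun x y => if y.val < x.val then x else if x.val < y.val then y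
    else ⟨x.layer + y.layer, x.val⟩⟩

theorem add_def (x y : Layered L G) : x + y = if y.val < x.val then x else
    if x.val < y.val then y else ⟨x.layer + y.layer, x.val⟩ := rfl

theorem mul_def (x y : Layered L G) : x * y = ⟨x.layer * y.layer, x.val * y.val⟩ := rfl

theorem one_def : (1 : Layered L G) = ⟨1, 1⟩ := rfl

instance : CommMonoid (Layered L G) where
  mul_assoc x y z := by simp [mul_def, mul_assoc]
  one_mul x := by simp [mul_def, one_def]
  mul_one x := by simp [mul_def, one_def]
  mul_comm x y := by simp [mul_def, mul_comm]

protected theorem add_comm' (x y : Layered L G) : x + y = y + x := by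
  rcases lt_trichotomy x.val y.val with h | h | h
  · simp [add_def, h, h.not_gt]
  · simp [add_def, h, add_comm]
  · simp [add_def, h, h.not_gt]

protected theorem add_assoc' (x y z : Layered L G) : x + y + z = x + (y + z) := by
  obtain ⟨k, a⟩ := x
  obtain ⟨l, b⟩ := y
  obtain ⟨m, c⟩ := z
  rcases lt_trichotomy a b with h | h | h <;> rcases lt_trichotomy b c with h' | h' | h'
  · have := h.trans h'
    simp [add_def, h, h', this, h.not_gt, h'.not_gt, this.not_gt]
  · subst h'
    simp [add_def, h, h.not_gt]
  · simp [add_def, h, h', h.not_gt, h'.not_gt]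
  · subst h
    simp [add_def, h', h'.not_gt]
  · subst h h'
    simp [add_def, add_assoc]
  · subst h
    simp [add_def, h', h'.not_gt]
  · rcases lt_trichotomy a c with h'' | h'' | h''
    · simp [add_def, h, h', h'', h.not_gt, h'.not_gt, h''.not_gt]
    · subst h''
      simp [add_def, h, h.not_gt]
    · simp [add_def, h, h', h'', h.not_gt, h'.not_gt, h''.not_gt]
  · subst h'
    simp [add_def, h, h.not_gt]
  · have := h'.trans h
    simp [add_def, h, h', this, h.not_gt, h'.not_gt, this.not_gt]

protected theorem mul_add' (x y z : Layered L G) : x * (y + z) = x * y + x * z := by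
  rcases lt_trichotomy y.val z.val with h | h | h
  · simp [add_def, mul_def, h, h.not_gt]
  · simp [add_def, mul_def, h, CommSemiringDagger.dagger_mul_add]
  · simp [add_def, mul_def, h, h.not_gt]

instance : AddCommSemigroup (Layered L G) where
  add_assoc := Layered.add_assoc'
  add_comm := Layered.add_comm'

instance : CommSemiringDagger (Layered L G) where
  dagger_mul_add := Layered.mul_add'

instance : Distrib (Layered L G) where
  left_distrib := Layered.mul_add'
  right_distrib x y z := by
    rw [mul_comm (x + y) z, Layered.mul_add', mul_comm z x, mul_comm z y]

end Layered

/-- `R(L, G)` with a zero element adjoined. -/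
abbrev LayeredZero (L G : Type*) := WithZero (Layered L G)

noncomputable section

namespace LayeredZero

variable {L G : Type*} [CommSemiringDagger L] [CommGroup G] [LinearOrder G] [IsOrderedMonoid G]

instance : CommSemiring (LayeredZero L G) where
  __ := (inferInstance : AddCommMonoid (WithZero (Layered L G)))
  __ := (inferInstance : CommMonoidWithZero (WithZero (Layered L G)))
  __ := (inferInstance : Distrib (WithZero (Layered L G)))

/-- The `ν`-value of an element; the adjoined zero has value `0`, the least element of
`WithZero G`. Two elements are `ν`-equivalent iff their `ν`-values agree. -/
def nu : LayeredZero L G → WithZero G :=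
  WithZero.recZeroCoe 0 fun a => (a.val : WithZero G)

/-- A polynomial is monic when its leading coefficient is `ν`-equivalent to `1` (in particular
the polynomial is nonzero); the layer of the leading coefficient is not restricted. -/
def NuMonic (f : (LayeredZero L G)[X]) : Prop := nu f.leadingCoeff = 1

/-- `f` is `a`-primary: it is monic, it is not divisible by the indeterminate, and each monomial
`α_i X ^ i` occurring in it satisfies `α_i ≅_ν a ^ (deg f - i)`. Only the `ν`-value `a : G` of the
corner root matters. -/
structure IsPrimary (a : G) (f : (LayeredZero L G)[X]) : Prop where
  monic : NuMonic f
  coeff_zero_ne : f.coeff 0 ≠ 0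
  nu_coeff : ∀ i, f.coeff i ≠ 0 → nu (f.coeff i) = ((a ^ (f.natDegree - i) : G) : WithZero G)

/-- The `i`-th monomial of `f` is strictly dominated at every point by some monomial of `f`
(depending on the point). Such a monomial never contributes to a value of `f`. -/
def StrictlyDominated (f : (LayeredZero L G)[X]) (i : ℕ) : Prop :=
  ∀ x : G, ∃ j, nu (f.coeff i) * (x : WithZero G) ^ i < nu (f.coeff j) * (x : WithZero G) ^ j

/-- `f` and `h` have the same coefficients, except possibly for monomials that are strictly
dominated everywhere, both in `f` and in `h`. -/
def EqUpToDominated (f h : (LayeredZero L G)[X]) : Prop :=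
  ∀ i, f.coeff i = h.coeff i ∨ (StrictlyDominated f i ∧ StrictlyDominated h i)

/-- `f` and `h` define the same function on `R(L, G)`. -/
def EqAsFunctions (f h : (LayeredZero L G)[X]) : Prop :=
  ∀ x : Layered L G, f.eval (x : LayeredZero L G) = h.eval (x : LayeredZero L G)

/-- `f = ∏ a ∈ A, fa a` is a primary decomposition of `f`, with pairwise `ν`-inequivalent corner
roots `a ∈ A`. The equality of polynomials is understood up to everywhere strictly dominated
monomials; when all layers are positive and finite, it may also be understood as an equality of
functions. -/
structure IsPrimaryDecomposition (f : (LayeredZero L G)[X]) (A : Finset G)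
    (fa : G → (LayeredZero L G)[X]) : Prop where
  primary : ∀ a ∈ A, IsPrimary a (fa a)
  eq_prod : EqUpToDominated f (∏ a ∈ A, fa a) ∨
    (AllPositiveFinite L ∧ EqAsFunctions f (∏ a ∈ A, fa a))

/-- The Sylvester matrix of `f = ∑ α_i X ^ i` and `g = ∑ β_j X ^ j` of degrees `m` and `n`: the
first `n` rows are the shifts of `(α_0, α_1, …, α_m)`, the last `m` rows are the shifts of
`(β_0, β_1, …, β_n)`, and all other entries are zero. -/
def sylvesterMatrix (m n : ℕ) (f g : (LayeredZero L G)[X]) :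
    Matrix (Fin (m + n)) (Fin (m + n)) (LayeredZero L G) :=
  Matrix.of fun r c =>
    if (r : ℕ) < n then
      (if (r : ℕ) ≤ c then f.coeff (c - r) else 0)
    else
      (if (r : ℕ) - n ≤ c then g.coeff (c - (r - n)) else 0)

/-- The layered resultant `|ℜ(f, g)|`: the permanent of the Sylvester matrix. (If `f` is a
constant, this is `α_0 ^ deg g`, and if `g` is a constant, it is `β_0 ^ deg f`.) -/
def layeredResultant (f g : (LayeredZero L G)[X]) : LayeredZero L G :=
  (sylvesterMatrix f.natDegree g.natDegree f g).permanent

end LayeredZero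

end

set_option linter.unusedSectionVars false

/-! Everything is computed modulo terms of smaller `ν`-value. `Cong v` is compatible with sums and
products, and it becomes an equality as soon as one side attains the value `v` (`Cong.eq_of_nu_eq`).
Near a root `d`, a primary factor with smaller root acts as its leading monomial and one with larger
root as its constant term, so the whole product acts as a constant times a power of `X` times the
factor at `d` (`polyCong_prod`).

Group the rows and columns of the Sylvester matrix by roots and weight them suitably. Entries whose
column root exceeds the row root then fall strictly below the weight, while each diagonal block
becomes, up to `Cong`, the Sylvester matrix of the two factors at `d` with rows scaled by cofactors.
The weights contribute the same total to every permutation, and the diagonal product of the block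
triangular model attains that total. Hence the two permanents are equal, not merely `ν`-equivalent,
and the model factors into its blocks (`layeredResultant_eq_prod`).

Applied to two roots with trivial factors `1`, this product formula evaluates the resultants for `a
≠ b`; the cofactor powers in the general formula are exactly the product of those values.

An equality of functions is reduced to one up to dominated monomials: evaluation at the multiples `k
+ 1` of a point reads off layers as a polynomial in `k + 1`, and a Vandermonde argument recovers its
coefficients (`EqAsFunctions.coeff_eq`). -/

namespace LayeredZero

/-! ### The `ν`-value, and congruence modulo smaller `ν`-value. -/

section Valuation

variable {L G : Type*} [CommSemiringDagger L] [CommGroup G] [LinearOrder G] [IsOrderedMonoid G]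

@[simp] theorem nu_zero : nu (0 : LayeredZero L G) = 0 := rfl

@[simp] theorem nu_coe (x : Layered L G) : nu (x : LayeredZero L G) = (x.val : WithZero G) := rfl

@[simp] theorem nu_one : nu (1 : LayeredZero L G) = 1 := rfl

theorem nu_mul (x y : LayeredZero L G) : nu (x * y) = nu x * nu y := by
  cases x using WithZero.recZeroCoe with
  | zero => simp
  | coe x =>
    cases y using WithZero.recZeroCoe with
    | zero => simp
    | coe y => rfl

/-- The `ν`-value as a homomorphism of monoids with zero. -/
def nuHom : LayeredZero L G →*₀ WithZero G where
  toFun := nu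
  map_zero' := nu_zero
  map_one' := nu_one
  map_mul' := nu_mul

theorem nu_pow (x : LayeredZero L G) (n : ℕ) : nu (x ^ n) = nu x ^ n := map_pow nuHom x n

theorem nu_prod {ι : Type*} (s : Finset ι) (x : ι → LayeredZero L G) :
    nu (∏ i ∈ s, x i) = ∏ i ∈ s, nu (x i) := map_prod nuHom x s

@[simp] theorem nu_eq_zero {x : LayeredZero L G} : nu x = 0 ↔ x = 0 := by
  cases x using WithZero.recZeroCoe <;> simp

theorem nu_add (x y : LayeredZero L G) : nu (x + y) = max (nu x) (nu y) := by
  cases x using WithZero.recZeroCoe with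
  | zero => simp
  | coe x =>
    cases y using WithZero.recZeroCoe with
    | zero => simp
    | coe y =>
      rw [← WithZero.coe_add, nu_coe, nu_coe, nu_coe, Layered.add_def]
      rcases lt_trichotomy x.val y.val with h | h | h
      · simp [h, h.not_gt, h.le]
      · simp [h]
      · simp [h, h.le]

theorem add_eq_left_of_nu_lt {x y : LayeredZero L G} (h : nu y < nu x) : x + y = x := by
  cases x using WithZero.recZeroCoe with
  | zero => simp at h
  | coe x =>
    cases y using WithZero.recZeroCoe with
    | zero => simp
    | coe y =>
      rw [nu_coe, nu_coe, WithZero.coe_lt_coe] at h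
      rw [← WithZero.coe_add, Layered.add_def, if_pos h]

theorem nu_le_nu_sum {ι : Type*} (s : Finset ι) (x : ι → LayeredZero L G) {i : ι} (hi : i ∈ s) :
    nu (x i) ≤ nu (∑ j ∈ s, x j) := by
  classical
  rw [← Finset.add_sum_erase s x hi, nu_add]
  exact le_max_left _ _

theorem nu_sum_le {ι : Type*} (s : Finset ι) (x : ι → LayeredZero L G) {v : WithZero G}
    (h : ∀ i ∈ s, nu (x i) ≤ v) : nu (∑ j ∈ s, x j) ≤ v := by
  classical
  induction s using Finset.induction_on with
  | empty => simp
  | insert i s his ih =>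
    rw [Finset.sum_insert his, nu_add]
    exact max_le (h i (by simp)) (ih fun j hj => h j (by simp [hj]))

instance : NoZeroDivisors (LayeredZero L G) where
  eq_zero_or_eq_zero_of_mul_eq_zero {x y} h := by
    rw [← nu_eq_zero, nu_mul, mul_eq_zero, nu_eq_zero, nu_eq_zero] at h
    exact h

instance : Nontrivial (LayeredZero L G) := inferInstanceAs (Nontrivial (WithZero (Layered L G)))

/-- `x` and `y` have `ν`-value at most `v`, and they agree up to terms of smaller `ν`-value. -/
def Cong (v : G) (x y : LayeredZero L G) : Prop :=
  (x = y ∧ nu x ≤ v) ∨ (nu x < v ∧ nu y < v)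

namespace Cong

variable {v w : G} {x y z x' y' : LayeredZero L G}

theorem refl (h : nu x ≤ v) : Cong v x x := Or.inl ⟨rfl, h⟩

theorem of_lt (h : nu x < v) (h' : nu y < v) : Cong v x y := Or.inr ⟨h, h'⟩

theorem zero : Cong v (0 : LayeredZero L G) 0 := refl (by simp)

theorem one : Cong (1 : G) (1 : LayeredZero L G) 1 := refl (by simp)

theorem nu_le (h : Cong v x y) : nu x ≤ v := by
  rcases h with h | h
  · exact h.2
  · exact h.1.le

theorem trans (h : Cong v x y) (h' : Cong v y z) : Cong v x z := by
  rcases h with ⟨rfl, h⟩ | h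
  · exact h'
  · rcases h' with ⟨rfl, -⟩ | h'
    · exact Or.inr h
    · exact Or.inr ⟨h.1, h'.2⟩

theorem symm (h : Cong v x y) : Cong v y x := by
  rcases h with ⟨rfl, h⟩ | h
  · exact refl h
  · exact Or.inr h.symm

/-- The passage from congruence back to equality: a side of value exactly `v` excludes the
alternative in which both sides are negligible. -/
theorem eq_of_nu_eq (h : Cong v x y) (hy : nu y = v) : x = y := by
  rcases h with h | h
  · exact h.1
  · exact absurd hy h.2.ne

theorem add_of_lt (h : nu x ≤ v) (hx' : nu x' < v) (hy' : nu y' < v) :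
    Cong v (x + x') (x + y') := by
  rcases h.lt_or_eq with h | h
  · exact of_lt (by simp [nu_add, h, hx']) (by simp [nu_add, h, hy'])
  · rw [add_eq_left_of_nu_lt (h ▸ hx'), add_eq_left_of_nu_lt (h ▸ hy')]
    exact refl h.le

theorem add (h : Cong v x y) (h' : Cong v x' y') : Cong v (x + x') (y + y') := by
  have key : Cong v (x + x') (x + y') := by
    rcases h' with ⟨rfl, h'⟩ | h'
    · exact refl (by simp [nu_add, h.nu_le, h'])
    · exact add_of_lt h.nu_le h'.1 h'.2
  refine key.trans ?_
  rcases h with ⟨rfl, h⟩ | h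
  · exact refl (by simp [nu_add, h, h'.symm.nu_le])
  · rw [add_comm x, add_comm y]
    exact add_of_lt h'.symm.nu_le h.1 h.2

theorem mul (h : Cong v x y) (h' : Cong w x' y') : Cong (v * w) (x * x') (y * y') := by
  have hv : (0 : WithZero G) < v := WithZero.zero_lt_coe v
  have hw : (0 : WithZero G) < w := WithZero.zero_lt_coe w
  have lt_of : ∀ {p q : LayeredZero L G}, nu p ≤ v → nu q < w →
      nu (p * q) < ((v * w : G) : WithZero G) := fun {p q} hp hq => by
    rw [nu_mul, WithZero.coe_mul]
    exact mul_lt_mul_of_le_of_lt_of_nonneg_of_pos hp hq zero_le hv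
  have lt_of' : ∀ {p q : LayeredZero L G}, nu p < v → nu q ≤ w →
      nu (p * q) < ((v * w : G) : WithZero G) := fun {p q} hp hq => by
    rw [nu_mul, WithZero.coe_mul]
    exact mul_lt_mul_of_lt_of_le_of_nonneg_of_pos hp hq zero_le hw
  rcases h with ⟨rfl, h⟩ | h
  · rcases h' with ⟨rfl, h'⟩ | h'
    · refine refl ?_
      rw [nu_mul, WithZero.coe_mul]
      exact mul_le_mul' h h'
    · exact of_lt (lt_of h h'.1) (lt_of h h'.2)
  · exact of_lt (lt_of' h.1 h'.nu_le) (lt_of' h.2 h'.symm.nu_le)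

theorem sum {ι : Type*} (s : Finset ι) {x y : ι → LayeredZero L G}
    (h : ∀ i ∈ s, Cong v (x i) (y i)) : Cong v (∑ i ∈ s, x i) (∑ i ∈ s, y i) := by
  classical
  induction s using Finset.induction_on with
  | empty => exact zero
  | insert i s his ih =>
    rw [Finset.sum_insert his, Finset.sum_insert his]
    exact (h i (by simp)).add (ih fun j hj => h j (by simp [hj]))

theorem prod {ι : Type*} (s : Finset ι) {v : ι → G} {x y : ι → LayeredZero L G}
    (h : ∀ i ∈ s, Cong (v i) (x i) (y i)) : Cong (∏ i ∈ s, v i) (∏ i ∈ s, x i) (∏ i ∈ s, y i) := by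
  classical
  induction s using Finset.induction_on with
  | empty => exact one
  | insert i s his ih =>
    rw [Finset.prod_insert his, Finset.prod_insert his, Finset.prod_insert his]
    exact (h i (by simp)).mul (ih fun j hj => h j (by simp [hj]))

end Cong

/-- The coefficients of `f` and `h` are congruent at the point `x`: the monomials of `f` and `h`
have `ν`-value at most `v` at `x`, and those of `ν`-value `v` coincide. -/
def PolyCong (x v : G) (f h : (LayeredZero L G)[X]) : Prop :=
  ∀ i, Cong (v * (x ^ i)⁻¹) (f.coeff i) (h.coeff i)

namespace PolyCong

variable {x v w : G} {f g h k : (LayeredZero L G)[X]}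

theorem trans (hfg : PolyCong x v f g) (hgh : PolyCong x v g h) : PolyCong x v f h :=
  fun i => (hfg i).trans (hgh i)

theorem symm (h : PolyCong x v f g) : PolyCong x v g f := fun i => (h i).symm

/-- The weight `v * (x ^ i)⁻¹` is multiplicative along each antidiagonal, so all terms of the
convolution are congruent at one common level. -/
theorem mul (h₁ : PolyCong x v f g) (h₂ : PolyCong x w h k) : PolyCong x (v * w) (f * h) (g * k) := by
  intro i
  rw [coeff_mul, coeff_mul]
  refine Cong.sum _ fun p hp => ?_
  rw [← Finset.HasAntidiagonal.mem_antidiagonal.mp hp, pow_add, mul_inv, mul_mul_mul_comm]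
  exact (h₁ p.1).mul (h₂ p.2)

theorem X_pow (r : ℕ) : PolyCong x (x ^ r) (X ^ r : (LayeredZero L G)[X]) (X ^ r) := by
  intro i
  rw [coeff_X_pow]
  split_ifs with h
  · subst h
    simpa using Cong.one
  · exact Cong.zero

theorem one : PolyCong x 1 (1 : (LayeredZero L G)[X]) 1 := by simpa using X_pow (L := L) (x := x) 0

theorem prod {ι : Type*} (s : Finset ι) {v : ι → G} {f g : ι → (LayeredZero L G)[X]}
    (h : ∀ i ∈ s, PolyCong x (v i) (f i) (g i)) :
    PolyCong x (∏ i ∈ s, v i) (∏ i ∈ s, f i) (∏ i ∈ s, g i) := by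
  classical
  induction s using Finset.induction_on with
  | empty => exact one
  | insert i s his ih =>
    rw [Finset.prod_insert his, Finset.prod_insert his, Finset.prod_insert his]
    exact (h i (by simp)).mul (ih fun j hj => h j (by simp [hj]))

end PolyCong

end Valuation

end LayeredZero

/-! ### Permanents: reindexing, row scaling, block triangular matrices. -/

namespace Matrix

variable {m n R : Type*} [Fintype m] [DecidableEq m] [Fintype n] [DecidableEq n] [CommSemiring R]

/-- Rows and columns may be reindexed independently, since a permanent carries no signs. -/
theorem permanent_submatrix_equiv (M : Matrix n n R) (e₁ e₂ : m ≃ n) :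
    (M.submatrix e₁ e₂).permanent = M.permanent := by
  unfold permanent
  refine Fintype.sum_equiv ((Equiv.equivCongr e₂ e₁)) _ _ fun σ => ?_
  exact Fintype.prod_equiv e₂ _ _ fun i => by simp [Equiv.equivCongr]

theorem permanent_mul_rows (s : n → R) (M : Matrix n n R) :
    (Matrix.of fun i j => s i * M i j).permanent = (∏ i, s i) * M.permanent := by
  unfold permanent
  rw [Finset.mul_sum]
  refine Finset.sum_congr rfl fun σ _ => ?_
  simp only [of_apply, Finset.prod_mul_distrib]
  rw [Equiv.prod_comp σ s]

/-- A permutation that never decreases a label, with values in an ordered cancellative monoid,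
preserves it. -/
theorem _root_.Equiv.Perm.label_eq_of_le {G : Type*} [CommGroup G] [LinearOrder G]
    [IsOrderedMonoid G] (σ : Equiv.Perm n) (l : n → G) (h : ∀ i, l i ≤ l (σ i)) (i : n) :
    l (σ i) = l i :=
  ((Finset.prod_eq_prod_iff_of_le fun i _ => h i).mp (Equiv.prod_comp σ l).symm i
    (Finset.mem_univ i)).symm

/-- The permanent of a block triangular matrix is the product of the permanents of its diagonal
blocks. -/
theorem permanent_sigma_of_triangular {G o : Type*} [CommGroup G] [LinearOrder G]
    [IsOrderedMonoid G] [Fintype o] [DecidableEq o] {β : o → Type*} [∀ d, Fintype (β d)]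
    [∀ d, DecidableEq (β d)] (l : o → G) (hl : Function.Injective l)
    (M : Matrix (Σ d, β d) (Σ d, β d) R) (hM : ∀ p q, l p.1 < l q.1 → M p q = 0) :
    M.permanent = ∏ d, (Matrix.of fun i j : β d => M ⟨d, i⟩ ⟨d, j⟩).permanent := by
  classical
  unfold permanent
  rw [Finset.prod_univ_sum, Fintype.piFinset_univ]
  symm
  -- The expanded product runs over families of permutations of the blocks. These embed into all
  -- permutations, and the remaining ones contribute zero.
  refine Finset.sum_of_injOn (fun σ => Equiv.Perm.sigmaCongrRightHom β σ)
    (fun σ _ τ _ h => Equiv.Perm.sigmaCongrRightHom_injective h) (by simp) ?_ ?_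
  · intro σ _ hσ
    by_contra hne
    have h0 : ∀ i, l i.1 ≤ l (σ i).1 := fun i => by
      by_contra! hlt
      exact hne (Finset.prod_eq_zero (Finset.mem_univ i) (hM _ _ hlt))
    -- A nonzero term never lowers the block label, hence it preserves every block.
    have h1 : ∀ i, (σ i).1 = i.1 := fun i => hl (σ.label_eq_of_le (fun i => l i.1) h0 i)
    have h2 : ∀ d i, ∃ j : β d, σ ⟨d, i⟩ = ⟨d, j⟩ := fun d i => by
      rcases hp : σ ⟨d, i⟩ with ⟨e, j⟩
      have he : e = d := by simpa [hp] using h1 ⟨d, i⟩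
      subst he
      exact ⟨j, rfl⟩
    choose τ hτ using h2
    have hinj : ∀ d, Function.Injective (τ d) := fun d i j hij => by
      have := σ.injective ((hτ d i).trans (hij ▸ (hτ d j).symm))
      simpa using this
    apply hσ
    simp only [Finset.coe_univ, Set.image_univ, Set.mem_range]
    refine ⟨fun d => Equiv.ofBijective (τ d) (Finite.injective_iff_bijective.mp (hinj d)), ?_⟩
    apply Equiv.ext
    rintro ⟨d, i⟩
    exact (hτ d i).symm
  · intro σ _
    rw [Fintype.prod_sigma]
    rfl

end Matrix

namespace LayeredZero

/-! ### Convexity of the product of the maxima. -/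

section Growth

variable {G : Type*} [CommGroup G] [LinearOrder G] [IsOrderedMonoid G]

/-- The value at `x` of the monic max-times polynomial with roots `a ∈ S` of multiplicity `k a`. -/
def growth (S : Finset G) (k : G → ℕ) (x : G) : G := ∏ a ∈ S, max a x ^ k a

/-- The number of roots less than `d`, counted with multiplicity `k`. -/
def below (S : Finset G) (k : G → ℕ) (d : G) : ℕ := ∑ a ∈ S, if a < d then k a else 0

variable {S : Finset G} {k : G → ℕ} {d e : G}

theorem below_add (hd : d ∈ S) : below S k d + k d = ∑ a ∈ S, if a ≤ d then k a else 0 := by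
  have : k d = ∑ a ∈ S, if a = d then k a else 0 := by simp [hd]
  rw [this, below, ← Finset.sum_add_distrib]
  refine Finset.sum_congr rfl fun a _ => ?_
  rcases lt_trichotomy a d with h | h | h
  · simp [h, h.ne, h.le]
  · simp [h]
  · simp [h.ne', h.not_gt, h.not_ge]

theorem below_add_le_sum (hd : d ∈ S) : below S k d + k d ≤ ∑ a ∈ S, k a := by
  rw [below_add hd]
  exact Finset.sum_le_sum fun a _ => by split_ifs <;> simp

theorem below_add_le_below (hd : d ∈ S) (h : d < e) : below S k d + k d ≤ below S k e := by
  rw [below_add hd]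
  refine Finset.sum_le_sum fun a _ => ?_
  split_ifs with h₁ h₂ h₂
  · rfl
  · exact absurd (h₁.trans_lt h) h₂
  · simp
  · rfl

/-- Convexity to the right of `d`: the slope of `growth` there is at least `below + k d`. The bound
is proved factor by factor at that exponent, and the positive deficit of `r` makes it strict. -/
theorem growth_mul_pow_lt {r : ℕ} (hd : d ∈ S) (hr : r < below S k d + k d) (h : d < e) :
    growth S k d * e ^ r < growth S k e * d ^ r := by
  have key : growth S k d * e ^ (below S k d + k d) ≤ growth S k e * d ^ (below S k d + k d) := by
    rw [below_add hd, ← Finset.prod_pow_eq_pow_sum, ← Finset.prod_pow_eq_pow_sum, growth, growth,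
      ← Finset.prod_mul_distrib, ← Finset.prod_mul_distrib]
    refine Finset.prod_le_prod' fun a _ => ?_
    split_ifs with ha
    · rw [max_eq_right ha, max_eq_right (ha.trans h.le), mul_comm]
    · simp only [pow_zero, mul_one]
      exact pow_le_pow_left' (max_le_max le_rfl h.le) _
  obtain ⟨t, ht⟩ := Nat.exists_eq_add_of_lt hr
  rw [ht, add_assoc, pow_add e r, pow_add d r, ← mul_assoc, ← mul_assoc] at key
  by_contra! hle
  exact (mul_lt_mul_of_le_of_lt hle (pow_lt_pow_left' (Nat.succ_ne_zero t) h)).not_ge key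

/-- Convexity to the left of `d`, where the slope is at most `below`. It is not strict, since `r`
may equal `below`; this is why the Sylvester matrix reduces to a block triangular rather than a
block diagonal one. -/
theorem growth_mul_pow_le {r : ℕ} (hr : below S k d ≤ r) (h : e < d) :
    growth S k d * e ^ r ≤ growth S k e * d ^ r := by
  have key : growth S k d * e ^ (below S k d) ≤ growth S k e * d ^ (below S k d) := by
    rw [below, ← Finset.prod_pow_eq_pow_sum, ← Finset.prod_pow_eq_pow_sum, growth, growth,
      ← Finset.prod_mul_distrib, ← Finset.prod_mul_distrib]
    refine Finset.prod_le_prod' fun a _ => ?_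
    split_ifs with ha
    · rw [max_eq_right ha.le, mul_comm]
      exact mul_le_mul_left (pow_le_pow_left' (le_max_right _ _) _) _
    · rw [max_eq_left (not_lt.mp ha), max_eq_left (h.le.trans (not_lt.mp ha))]
      simp
  obtain ⟨t, rfl⟩ := Nat.exists_eq_add_of_le hr
  rw [pow_add, pow_add, ← mul_assoc, ← mul_assoc]
  exact mul_le_mul' key (pow_le_pow_left' h.le _)

end Growth

/-! ### Local shape of primary polynomials and of their products. -/

section Primary

variable {L G : Type*} [CommSemiringDagger L] [CommGroup G] [LinearOrder G] [IsOrderedMonoid G]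

theorem NuMonic.ne_zero {f : (LayeredZero L G)[X]} (h : NuMonic f) : f ≠ 0 := by
  rintro rfl
  simp [NuMonic] at h

theorem NuMonic.prod {ι : Type*} {S : Finset ι} {F : ι → (LayeredZero L G)[X]}
    (h : ∀ a ∈ S, NuMonic (F a)) : NuMonic (∏ a ∈ S, F a) := by
  unfold NuMonic
  rw [leadingCoeff_prod, nu_prod]
  exact Finset.prod_eq_one h

namespace IsPrimary

variable {a x : G} {F : (LayeredZero L G)[X]}

theorem one (a : G) : IsPrimary a (1 : (LayeredZero L G)[X]) where
  monic := by simp [NuMonic]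
  coeff_zero_ne := by simp
  nu_coeff i hi := by
    rw [coeff_one] at hi ⊢
    split_ifs at hi ⊢ with h
    · simp
    · exact absurd rfl hi

theorem nu_coeff_zero (hF : IsPrimary a F) : nu (F.coeff 0) = ((a ^ F.natDegree : G) : WithZero G) := by
  simpa using hF.nu_coeff 0 hF.coeff_zero_ne

theorem nu_coeff_le (hF : IsPrimary a F) (i : ℕ) :
    nu (F.coeff i) ≤ ((a ^ F.natDegree * (a ^ i)⁻¹ : G) : WithZero G) := by
  by_cases h : F.coeff i = 0
  · simp [h]
  · rw [hF.nu_coeff i h, pow_sub _ (le_natDegree_of_ne_zero h)]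

theorem polyCong_self (hF : IsPrimary a F) : PolyCong a (a ^ F.natDegree) F F :=
  fun i => Cong.refl (hF.nu_coeff_le i)

/-- To the right of the root, the leading monomial strictly dominates all the others. -/
theorem polyCong_of_lt (hF : IsPrimary a F) (h : a < x) :
    PolyCong x (x ^ F.natDegree) F (C F.leadingCoeff * X ^ F.natDegree) := by
  intro i
  rw [coeff_C_mul_X_pow]
  split_ifs with hi
  · subst hi
    rw [coeff_natDegree]
    refine Cong.refl ?_
    rw [show nu F.leadingCoeff = 1 from hF.monic]
    simp
  · by_cases h0 : F.coeff i = 0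
    · rw [h0]; exact Cong.zero
    have hlt := lt_of_le_of_ne (le_natDegree_of_ne_zero h0) hi
    refine Cong.of_lt ?_ (by simp)
    rw [hF.nu_coeff i h0, ← pow_sub _ hlt.le, WithZero.coe_lt_coe]
    exact pow_lt_pow_left' (Nat.sub_ne_zero_of_lt hlt) h

/-- To the left of the root, the constant term strictly dominates all the others. -/
theorem polyCong_of_gt (hF : IsPrimary a F) (h : x < a) :
    PolyCong x (a ^ F.natDegree) F (C (F.coeff 0)) := by
  intro i
  rw [coeff_C]
  split_ifs with hi
  · subst hi
    refine Cong.refl ?_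
    rw [hF.nu_coeff_zero]
    simp
  · refine Cong.of_lt ((hF.nu_coeff_le i).trans_lt ?_) (by simp)
    rw [WithZero.coe_lt_coe]
    exact mul_lt_mul_right (inv_lt_inv_iff.mpr (pow_lt_pow_left' hi h)) _

end IsPrimary

/-- The coefficient by which the product of the factors other than `F d` acts near the point `d`:
the leading coefficients of the factors with smaller root times the constant terms of the factors
with larger root. -/
noncomputable def cofactor (S : Finset G) (F : G → (LayeredZero L G)[X]) (d : G) :
    LayeredZero L G :=
  ∏ a ∈ S, if a < d then (F a).leadingCoeff else if d < a then (F a).coeff 0 else 1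

variable {S : Finset G} {F : G → (LayeredZero L G)[X]} {d : G}

theorem polyCong_prod (hF : ∀ a ∈ S, IsPrimary a (F a)) (hd : d ∈ S) :
    PolyCong d (growth S (fun a => (F a).natDegree) d) (∏ a ∈ S, F a)
      (C (cofactor S F d) * X ^ below S (fun a => (F a).natDegree) d * F d) := by
  have : C (cofactor S F d) * X ^ below S (fun a => (F a).natDegree) d * F d =
      ∏ a ∈ S, C (if a < d then (F a).leadingCoeff else if d < a then (F a).coeff 0 else 1) *
        X ^ (if a < d then (F a).natDegree else 0) * (if d = a then F a else 1) := by
    rw [Finset.prod_mul_distrib, Finset.prod_mul_distrib, Finset.prod_ite_eq, if_pos hd,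
      Finset.prod_pow_eq_pow_sum, cofactor, map_prod]
    rfl
  rw [this]
  refine PolyCong.prod S fun a ha => ?_
  rcases lt_trichotomy a d with h | rfl | h
  · simpa [h, h.ne', h.le] using (hF a ha).polyCong_of_lt h
  · simpa using (hF a ha).polyCong_self
  · simpa [h, h.ne, h.not_gt, h.le] using (hF a ha).polyCong_of_gt h

/-- Sharpness of the bound in `polyCong_prod`: at `d`, the leading monomial of the local model
attains the value `growth`. -/
theorem nu_cofactor_mul (hF : ∀ a ∈ S, IsPrimary a (F a)) (hd : d ∈ S) :
    nu (cofactor S F d) * ((d ^ below S (fun a => (F a).natDegree) d * d ^ (F d).natDegree : G) :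
      WithZero G) = growth S (fun a => (F a).natDegree) d := by
  have : (d ^ below S (fun a => (F a).natDegree) d * d ^ (F d).natDegree : G) =
      ∏ a ∈ S, d ^ (if a < d then (F a).natDegree else 0) *
        (if d = a then d ^ (F a).natDegree else 1) := by
    rw [Finset.prod_mul_distrib, Finset.prod_ite_eq, if_pos hd, Finset.prod_pow_eq_pow_sum]
    rfl
  have coe_prod : ∀ u : G → G, ((∏ a ∈ S, u a : G) : WithZero G) = ∏ a ∈ S, (u a : WithZero G) :=
    fun u => map_prod (WithZero.coeMonoidHom (α := G)) u S
  rw [this, cofactor, nu_prod, growth, coe_prod, coe_prod, ← Finset.prod_mul_distrib]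
  refine Finset.prod_congr rfl fun a ha => ?_
  rcases lt_trichotomy a d with h | rfl | h
  · simp [h, h.ne', h.le, show nu (F a).leadingCoeff = 1 from (hF a ha).monic]
  · simp
  · simp [h, h.ne, h.not_gt, h.le, (hF a ha).nu_coeff_zero]

theorem natDegree_prod_of_primary (hF : ∀ a ∈ S, IsPrimary a (F a)) :
    (∏ a ∈ S, F a).natDegree = ∑ a ∈ S, (F a).natDegree :=
  natDegree_prod _ _ fun a ha => (hF a ha).monic.ne_zero

end Primary

end LayeredZero

namespace LayeredZero

/-! ### Grouping row and column indices by roots. -/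

section BlockIndex

variable {G : Type*} [CommGroup G] [LinearOrder G] [IsOrderedMonoid G]
variable {S : Finset G} {m n : G → ℕ}

/-- The intervals of length `n a` starting at `below S n a` are pairwise disjoint. -/
theorem below_label_injective {a b : G} (ha : a ∈ S) (hb : b ∈ S) {i j : ℕ} (hi : i < n a)
    (hj : j < n b) (h : below S n a + i = below S n b + j) : a = b ∧ i = j := by
  rcases lt_trichotomy a b with hab | rfl | hab
  · have := below_add_le_below (k := n) ha hab
    omega
  · exact ⟨rfl, by omega⟩
  · have := below_add_le_below (k := n) hb hab
    omega

/-- The row of the Sylvester matrix that becomes row `i` of the block of the root `d`. -/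
def rowIdx (S : Finset G) (m n : G → ℕ) (d : G) (i : ℕ) : ℕ :=
  if i < n d then below S n d + i else (∑ a ∈ S, n a) + (below S m d + (i - n d))

theorem rowIdx_lt {d : G} (hd : d ∈ S) {i : ℕ} (hi : i < m d + n d) :
    rowIdx S m n d i < (∑ a ∈ S, m a) + ∑ a ∈ S, n a := by
  have h₁ := below_add_le_sum (k := n) hd
  have h₂ := below_add_le_sum (k := m) hd
  unfold rowIdx
  split_ifs <;> omega

theorem rowIdx_injective {d e : G} (hd : d ∈ S) (he : e ∈ S) {i j : ℕ} (hi : i < m d + n d)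
    (hj : j < m e + n e) (h : rowIdx S m n d i = rowIdx S m n e j) : d = e ∧ i = j := by
  have h₁ := below_add_le_sum (k := n) hd
  have h₂ := below_add_le_sum (k := n) he
  unfold rowIdx at h
  split_ifs at h with hi' hj' hj'
  · exact below_label_injective hd he hi' hj' h
  · omega
  · omega
  · obtain ⟨rfl, h⟩ := below_label_injective (n := m) hd he (i := i - n d) (j := j - n e)
      (by omega) (by omega) (by omega)
    exact ⟨rfl, by omega⟩

theorem below_add_fun (d : G) :
    below S (fun a => m a + n a) d = below S m d + below S n d := by
  unfold below
  rw [← Finset.sum_add_distrib]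
  exact Finset.sum_congr rfl fun a _ => by split_ifs <;> rfl

/-- Rows of the Sylvester matrix, grouped into blocks according to the roots. -/
noncomputable def rowEquiv (S : Finset G) (m n : G → ℕ) {M N : ℕ} (hM : M = ∑ a ∈ S, m a)
    (hN : N = ∑ a ∈ S, n a) : (Σ d : S, Fin (m d + n d)) ≃ Fin (M + N) :=
  Equiv.ofBijective
    (fun p => ⟨rowIdx S m n p.1 p.2, by subst hM hN; exact rowIdx_lt p.1.2 p.2.2⟩)
    ((Fintype.bijective_iff_injective_and_card _).mpr ⟨by
      rintro ⟨⟨d, hd⟩, i, hi⟩ ⟨⟨e, he⟩, j, hj⟩ h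
      obtain ⟨rfl, rfl⟩ := rowIdx_injective hd he hi hj (Fin.mk.inj h)
      rfl, by
      subst hM hN
      simp [Finset.sum_add_distrib, Finset.sum_attach S m, Finset.sum_attach S n]⟩)

/-- Columns of the Sylvester matrix, grouped into blocks according to the roots. -/
noncomputable def colEquiv (S : Finset G) (m n : G → ℕ) {M N : ℕ} (hM : M = ∑ a ∈ S, m a)
    (hN : N = ∑ a ∈ S, n a) : (Σ d : S, Fin (m d + n d)) ≃ Fin (M + N) :=
  Equiv.ofBijective
    (fun p => ⟨below S m p.1 + below S n p.1 + p.2, by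
      subst hM hN
      have h₁ := below_add_le_sum (k := n) p.1.2
      have h₂ := below_add_le_sum (k := m) p.1.2
      have := p.2.2
      omega⟩)
    ((Fintype.bijective_iff_injective_and_card _).mpr ⟨by
      rintro ⟨⟨d, hd⟩, i, hi⟩ ⟨⟨e, he⟩, j, hj⟩ h
      have h' := Fin.mk.inj h
      simp only [← below_add_fun] at h'
      obtain ⟨rfl, rfl⟩ := below_label_injective (n := fun a => m a + n a) hd he hi hj h'
      rfl, by
      subst hM hN
      simp [Finset.sum_add_distrib, Finset.sum_attach S m, Finset.sum_attach S n]⟩)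

end BlockIndex

/-! ### Reduction of the Sylvester matrix to block triangular form. -/

section Core

variable {L G : Type*} [CommSemiringDagger L] [CommGroup G] [LinearOrder G] [IsOrderedMonoid G]

theorem sylvesterMatrix_apply (m n : ℕ) (f g : (LayeredZero L G)[X]) (r c : Fin (m + n)) :
    sylvesterMatrix m n f g r c =
      if (r : ℕ) < n then (X ^ (r : ℕ) * f).coeff c else (X ^ ((r : ℕ) - n) * g).coeff c := by
  simp only [sylvesterMatrix, Matrix.of_apply, coeff_X_pow_mul']

variable {S : Finset G} {F : G → (LayeredZero L G)[X]} {f : (LayeredZero L G)[X]} {d e : G}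

theorem cong_row_coeff (hF : ∀ a ∈ S, IsPrimary a (F a))
    (hf : ∀ a ∈ S, PolyCong a (growth S (fun a => (F a).natDegree) a) f (∏ a ∈ S, F a))
    (he : e ∈ S) (r c : ℕ) :
    Cong (e ^ r * growth S (fun a => (F a).natDegree) e * (e ^ c)⁻¹) ((X ^ r * f).coeff c)
      ((X ^ r * (C (cofactor S F e) * X ^ below S (fun a => (F a).natDegree) e * F e)).coeff c) :=
  (PolyCong.X_pow r).mul ((hf e he).trans (polyCong_prod hF he)) c

/-- A row of the Sylvester matrix, with label `d`, against a column with label `e`. -/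
theorem cong_row_entry (hF : ∀ a ∈ S, IsPrimary a (F a))
    (hf : ∀ a ∈ S, PolyCong a (growth S (fun a => (F a).natDegree) a) f (∏ a ∈ S, F a))
    (hd : d ∈ S) (he : e ∈ S) (n : G → ℕ) {i : ℕ} (hi : i < n d) (j : ℕ) (z : LayeredZero L G)
    (hz : z = if e < d then (X ^ (below S n d + i) * f).coeff
        (below S (fun a => (F a).natDegree) e + below S n e + j)
      else if d < e then 0 else cofactor S F d * (X ^ i * F d).coeff j) :
    Cong (d ^ (below S n d + i) * (growth S n d)⁻¹ *
        (growth S (fun a => (F a).natDegree) e * growth S n e *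
          (e ^ (below S (fun a => (F a).natDegree) e + below S n e + j))⁻¹))
      ((X ^ (below S n d + i) * f).coeff
        (below S (fun a => (F a).natDegree) e + below S n e + j)) z := by
  set m : G → ℕ := fun a => (F a).natDegree
  set r := below S n d + i with hr
  set c := below S m e + below S n e + j with hc
  have key := cong_row_coeff hF hf he r c
  -- Both weights share a common factor. What remains is to compare `growth S n e * d ^ r` with
  -- `growth S n d * e ^ r`, which is convexity for the degrees of the other polynomial.
  have comm : d ^ r * (growth S n d)⁻¹ * (growth S m e * growth S n e * (e ^ c)⁻¹) =
      growth S n e * d ^ r * ((growth S n d)⁻¹ * (growth S m e * (e ^ c)⁻¹)) := by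
    simp only [mul_comm, mul_left_comm, mul_assoc]
  have comm' : e ^ r * growth S m e * (e ^ c)⁻¹ =
      growth S n d * e ^ r * ((growth S n d)⁻¹ * (growth S m e * (e ^ c)⁻¹)) := by
    rw [mul_comm (growth S n d), mul_assoc (e ^ r) (growth S n d), mul_inv_cancel_left, mul_assoc]
  rw [comm]
  rw [comm'] at key
  subst hz
  rcases lt_trichotomy d e with h | rfl | h
  · rw [if_neg h.not_gt, if_pos h]
    have hlt := growth_mul_pow_lt (k := n) hd (r := r) (by omega) h
    refine Cong.of_lt (key.nu_le.trans_lt ?_) (by simp)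
    rw [WithZero.coe_lt_coe]
    exact mul_lt_mul_left hlt _
  · rw [if_neg (lt_irrefl _), if_neg (lt_irrefl _)]
    have : (X ^ r * (C (cofactor S F d) * X ^ below S m d * F d)).coeff c =
        cofactor S F d * (X ^ i * F d).coeff j := by
      rw [show X ^ r * (C (cofactor S F d) * X ^ below S m d * F d) =
        X ^ (below S m d + below S n d) * (C (cofactor S F d) * (X ^ i * F d)) by
          rw [hr]; ring, hc, add_comm _ j, coeff_X_pow_mul, coeff_C_mul]
    rwa [this] at key
  · rw [if_pos h]
    -- On this side of the diagonal only an upper bound is needed: the entry is kept unchanged.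
    refine Cong.refl (key.nu_le.trans ?_)
    rw [WithZero.coe_le_coe]
    exact mul_le_mul_left (growth_mul_pow_le (by omega) h) _

theorem nu_cofactor (hF : ∀ a ∈ S, IsPrimary a (F a)) (hd : d ∈ S) :
    nu (cofactor S F d) = ((growth S (fun a => (F a).natDegree) d *
      (d ^ below S (fun a => (F a).natDegree) d * d ^ (F d).natDegree)⁻¹ : G) : WithZero G) := by
  rw [WithZero.coe_mul, ← nu_cofactor_mul hF hd, mul_assoc, ← WithZero.coe_mul, mul_inv_cancel]
  simp

theorem mul_inv_eq_mul_mul_mul_inv (a b w y : G) :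
    b * w⁻¹ = y * a⁻¹ * (a * b * (w * y)⁻¹) := by
  rw [mul_assoc a b, mul_assoc y, inv_mul_cancel_left, mul_inv, mul_left_comm, mul_comm w⁻¹,
    mul_inv_cancel_left]

theorem prod_ite_lt_fin {M : Type*} [CommMonoid M] (m n : ℕ) (x y : M) :
    ∏ i : Fin (m + n), (if (i : ℕ) < n then x else y) = x ^ n * y ^ m := by
  rw [Finset.prod_range (fun i => if i < n then x else y) |>.symm, add_comm m n,
    Finset.prod_range_add]
  congr 1
  · rw [Finset.prod_congr rfl fun i hi => if_pos (Finset.mem_range.mp hi)]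
    simp
  · simp

/-- The resultant of two polynomials that agree near every root with products of primary
polynomials, as a product over the roots. -/
theorem layeredResultant_eq_prod {F K : G → (LayeredZero L G)[X]} {f g : (LayeredZero L G)[X]}
    (hF : ∀ a ∈ S, IsPrimary a (F a)) (hK : ∀ a ∈ S, IsPrimary a (K a))
    (hf : ∀ a ∈ S, PolyCong a (growth S (fun a => (F a).natDegree) a) f (∏ a ∈ S, F a))
    (hg : ∀ a ∈ S, PolyCong a (growth S (fun a => (K a).natDegree) a) g (∏ a ∈ S, K a))
    (hfd : f.natDegree = ∑ a ∈ S, (F a).natDegree) (hgd : g.natDegree = ∑ a ∈ S, (K a).natDegree) :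
    layeredResultant f g = ∏ d ∈ S, cofactor S F d ^ (K d).natDegree *
      cofactor S K d ^ (F d).natDegree * layeredResultant (F d) (K d) := by
  classical
  set m : G → ℕ := fun a => (F a).natDegree with hm
  set n : G → ℕ := fun a => (K a).natDegree with hn
  let A := (sylvesterMatrix f.natDegree g.natDegree f g).submatrix (rowEquiv S m n hfd hgd)
    (colEquiv S m n hfd hgd)
  -- The block triangular model: entries with smaller column root are copied, those with larger
  -- column root are dropped, and the diagonal blocks use the local models.
  let B : Matrix (Σ d : S, Fin (m d + n d)) (Σ d : S, Fin (m d + n d)) (LayeredZero L G) :=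
    fun p q => if (q.1 : G) < p.1 then A p q else if (p.1 : G) < q.1 then 0 else
      if (p.2 : ℕ) < n p.1 then cofactor S F p.1 * (X ^ (p.2 : ℕ) * F p.1).coeff q.2
      else cofactor S K p.1 * (X ^ ((p.2 : ℕ) - n p.1) * K p.1).coeff q.2
  let u : (Σ d : S, Fin (m d + n d)) → G := fun p =>
    if (p.2 : ℕ) < n p.1 then (p.1 : G) ^ (below S n p.1 + p.2) * (growth S n p.1)⁻¹
    else (p.1 : G) ^ (below S m p.1 + (p.2 - n p.1)) * (growth S m p.1)⁻¹
  let v : (Σ d : S, Fin (m d + n d)) → G := fun q =>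
    growth S m q.1 * growth S n q.1 * ((q.1 : G) ^ (below S m q.1 + below S n q.1 + q.2))⁻¹
  have hA : ∀ p q, A p q = if (p.2 : ℕ) < n p.1
      then (X ^ (below S n p.1 + p.2) * f).coeff (below S m q.1 + below S n q.1 + q.2)
      else (X ^ (below S m p.1 + (p.2 - n p.1)) * g).coeff
        (below S m q.1 + below S n q.1 + q.2) := by
    rintro ⟨⟨d, hd⟩, i, hi⟩ ⟨⟨e, he⟩, j, hj⟩
    have h₁ : below S n d + n d ≤ g.natDegree := hgd ▸ below_add_le_sum (k := n) hd
    simp only [A, Matrix.submatrix_apply, sylvesterMatrix_apply, rowEquiv, colEquiv,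
      Equiv.ofBijective_apply, rowIdx]
    by_cases h : i < n d
    · rw [if_pos h, if_pos h, if_pos (by omega)]
    · rw [if_neg h, if_neg h, ← hgd, if_neg (by omega), Nat.add_sub_cancel_left]
  have hAB : ∀ p q, Cong (u p * v q) (A p q) (B p q) := by
    rintro ⟨⟨d, hd⟩, i, hi⟩ ⟨⟨e, he⟩, j, hj⟩
    simp only [B, hA, u, v]
    by_cases h : i < n d
    · simp only [if_pos h]
      exact cong_row_entry hF hf hd he n h j _ rfl
    · simp only [if_neg h]
      -- The rows of `g` are handled by exchanging the two polynomials, along with the degrees that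
      -- define the weights.
      have := cong_row_entry hK hg hd he m (i := i - n d) (by replace hi : i < m d + n d := hi; omega) j _ rfl
      rw [mul_comm (growth S m e), add_comm (below S m e)]
      exact this
  have hperm : Cong (∏ p, u p * v p) A.permanent B.permanent := by
    refine Cong.sum _ fun σ _ => ?_
    -- The total weight is independent of `σ`, so all terms of the permanent are compared at the
    -- same level.
    have : ∏ p, u p * v p = ∏ p, u (σ p) * v p := by
      rw [Finset.prod_mul_distrib (f := u), Finset.prod_mul_distrib (f := fun p => u (σ p)),
        Equiv.prod_comp σ u]
    rw [this]
    exact Cong.prod _ fun p _ => hAB _ _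
  -- The diagonal meets the constant term of `F d` in the first `n d` rows of a block and the
  -- leading coefficient of `K d` in the others; both have maximal weight.
  have hdiag : ∀ p, nu (B p p) = (u p * v p : G) := by
    rintro ⟨⟨d, hd⟩, i, hi⟩
    simp only [B, u, v, lt_irrefl, if_false]
    by_cases h : i < n d
    · simp only [if_pos h]
      rw [coeff_X_pow_mul', if_pos le_rfl, Nat.sub_self, nu_mul, (hF d hd).nu_coeff_zero,
        nu_cofactor hF hd, ← WithZero.coe_mul, WithZero.coe_inj]
      change growth S m d * (d ^ below S m d * d ^ m d)⁻¹ * d ^ m d = _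
      rw [add_assoc, pow_add _ (below S m d), mul_comm (growth S m d) (growth S n d),
        ← mul_inv_eq_mul_mul_mul_inv, mul_inv, ← mul_assoc, inv_mul_cancel_right]
    · simp only [if_neg h]
      replace hi : i < m d + n d := hi
      have hpow : d ^ (below S m d + below S n d + i) =
          d ^ (below S n d) * d ^ n d * d ^ (below S m d + (i - n d)) := by
        rw [← pow_add, ← pow_add]
        congr 1
        omega
      have hK1 : nu ((K d).coeff (n d)) = 1 := (hK d hd).monic
      rw [coeff_X_pow_mul', if_pos (Nat.sub_le _ _), Nat.sub_sub_self (not_lt.mp h), nu_mul, hK1,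
        nu_cofactor hK hd, mul_one, WithZero.coe_inj, hpow]
      exact mul_inv_eq_mul_mul_mul_inv _ _ _ _
  have hB : nu B.permanent = (∏ p, u p * v p : G) := by
    refine le_antisymm hperm.symm.nu_le ?_
    have := nu_le_nu_sum Finset.univ (fun σ : Equiv.Perm (Σ d : S, Fin (m d + n d)) =>
      ∏ p, B (σ p) p) (Finset.mem_univ 1)
    refine le_trans (le_of_eq ?_) this
    rw [nu_prod]
    simp only [Equiv.Perm.coe_one, id_eq, hdiag]
    exact map_prod (WithZero.coeMonoidHom (α := G)) _ _
  have hres : layeredResultant f g = B.permanent :=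
    (Matrix.permanent_submatrix_equiv _ _ _).symm.trans (hperm.eq_of_nu_eq hB)
  rw [hres, Matrix.permanent_sigma_of_triangular (fun d : S => (d : G)) Subtype.val_injective B
    (fun p q h => by simp only [B, if_neg h.not_gt, if_pos h]),
    ← Finset.prod_coe_sort S]
  refine Finset.prod_congr rfl fun d _ => ?_
  -- The cofactor powers are the scalars of the `n d` rows from `F d` and of the `m d` rows from `K
  -- d`.
  rw [← prod_ite_lt_fin, layeredResultant, ← Matrix.permanent_mul_rows]
  congr 1
  ext i j
  simp only [B, Matrix.of_apply, lt_irrefl, if_false, sylvesterMatrix_apply, hn]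
  split_ifs <;> rfl

end Core

end LayeredZero

/-! ### Recovering coefficients from values at positive integers. -/

/-- A polynomial expression with coefficients in a torsion-free abelian group that vanishes at
all positive integers has zero coefficients. -/
theorem eq_zero_of_forall_sum_pow_nsmul_eq_zero {Γ : Type*} [AddCommGroup Γ]
    (htf : ∀ (k : ℤ) (x : Γ), k ≠ 0 → k • x = 0 → x = 0) {N : ℕ} (w : Fin N → Γ)
    (hw : ∀ k : ℕ, ∑ i : Fin N, (k + 1) ^ (i : ℕ) • w i = 0) (i : Fin N) : w i = 0 := by
  let A : Matrix (Fin N) (Fin N) ℤ := Matrix.vandermonde fun j => ((j : ℕ) + 1 : ℤ)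
  have hA : A.det ≠ 0 := Matrix.det_vandermonde_ne_zero_iff.mpr fun j k h => by
    ext
    simpa using h
  have hrow : ∀ j, ∑ l, A j l • w l = 0 := fun j => by
    rw [← hw j]
    refine Finset.sum_congr rfl fun l _ => ?_
    rw [← natCast_zsmul]
    simp [A, Matrix.vandermonde_apply]
  -- Multiplication by the adjugate turns the linear system into `det • w i = 0`, with no division.
  refine htf A.det _ hA ?_
  calc A.det • w i = ∑ l, (A.adjugate * A) i l • w l := by
        rw [Matrix.adjugate_mul]
        simp [Matrix.one_apply]
    _ = ∑ j, A.adjugate i j • ∑ l, A j l • w l := by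
        simp only [Matrix.mul_apply, Finset.sum_smul, Finset.smul_sum, mul_smul]
        exact Finset.sum_comm
    _ = 0 := by simp [hrow]

section Layers

variable {L : Type*} [CommSemiringDagger L]

namespace AllPositiveFinite

theorem withZero_exists_add (h : AllPositiveFinite L) (a b : WithZero L) :
    (∃ p, b = a + p) ∨ ∃ p, a = b + p := by
  cases a using WithZero.recZeroCoe with
  | zero => exact Or.inl ⟨b, (zero_add b).symm⟩
  | coe a =>
    cases b using WithZero.recZeroCoe with
    | zero => exact Or.inr ⟨a, (zero_add _).symm⟩
    | coe b =>
      by_cases hab : a = b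
      · exact Or.inl ⟨0, by simp [hab]⟩
      · rcases h.1 a b hab with ⟨p, rfl⟩ | ⟨p, rfl⟩
        · exact Or.inl ⟨p, rfl⟩
        · exact Or.inr ⟨p, rfl⟩

theorem withZero_eq_zero_of_add_eq (h : AllPositiveFinite L) {a p : WithZero L} (hp : a + p = a) :
    p = 0 := by
  cases p using WithZero.recZeroCoe with
  | zero => rfl
  | coe p =>
    cases a using WithZero.recZeroCoe with
    | zero => simp at hp
    | coe a =>
      rw [← WithZero.coe_add, WithZero.coe_inj] at hp
      exact absurd hp (h.2 a p)

/-- Of two elements, one is the other plus some `p`; cancellation would fail only if a nonzero `p`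
could be absorbed, which finiteness forbids. -/
theorem withZero_add_left_cancel (h : AllPositiveFinite L) {a b c : WithZero L}
    (hc : c + a = c + b) : a = b := by
  rcases h.withZero_exists_add a b with ⟨p, rfl⟩ | ⟨p, rfl⟩
  · rw [← add_assoc] at hc
    rw [h.withZero_eq_zero_of_add_eq hc.symm, add_zero]
  · rw [← add_assoc] at hc
    rw [h.withZero_eq_zero_of_add_eq hc, add_zero]

theorem withZero_nsmul_eq_zero {p : WithZero L} {n : ℕ} (hn : n ≠ 0) (h : n • p = 0) : p = 0 := by
  obtain ⟨n, rfl⟩ := Nat.exists_eq_succ_of_ne_zero hn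
  rw [succ_nsmul] at h
  cases p using WithZero.recZeroCoe with
  | zero => rfl
  | coe p =>
    generalize n • (p : WithZero L) = q at h
    cases q using WithZero.recZeroCoe with
    | zero => simp at h
    | coe q =>
      rw [← WithZero.coe_add] at h
      exact absurd h WithZero.coe_ne_zero

theorem withZero_nsmul_cancel (h : AllPositiveFinite L) {a b : WithZero L} {n : ℕ} (hn : n ≠ 0)
    (hab : n • a = n • b) : a = b := by
  rcases h.withZero_exists_add a b with ⟨p, rfl⟩ | ⟨p, rfl⟩
  · rw [nsmul_add] at hab
    rw [withZero_nsmul_eq_zero hn (h.withZero_eq_zero_of_add_eq hab.symm), add_zero]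
  · rw [nsmul_add] at hab
    rw [withZero_nsmul_eq_zero hn (h.withZero_eq_zero_of_add_eq hab), add_zero]

open Algebra in
theorem grothendieck_of_injective (h : AllPositiveFinite L) :
    Function.Injective (GrothendieckAddGroup.of : WithZero L →+ GrothendieckAddGroup (WithZero L)) := by
  intro a b hab
  obtain ⟨c, hc⟩ := (AddLocalization.addMonoidOf (⊤ : AddSubmonoid (WithZero L))).eq_iff_exists.mp hab
  exact h.withZero_add_left_cancel hc

open Algebra in
-- With `x` written as `a - b`, torsion gives `n • a = n • b` in `WithZero L`, where `n` can be
-- cancelled.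
theorem grothendieck_torsionFree (h : AllPositiveFinite L) (k : ℤ)
    (x : GrothendieckAddGroup (WithZero L)) (hk : k ≠ 0) (hx : k • x = 0) : x = 0 := by
  have hn : k.natAbs • x = 0 := by
    rcases Int.natAbs_eq k with hk' | hk'
    · rw [← natCast_zsmul, ← hk', hx]
    · rw [← natCast_zsmul, ← neg_eq_zero, ← neg_smul, ← hk', hx]
  obtain ⟨⟨a, b⟩, hab⟩ :=
    (AddLocalization.addMonoidOf (⊤ : AddSubmonoid (WithZero L))).surj x
  have hab' : x + GrothendieckAddGroup.of (b : WithZero L) = GrothendieckAddGroup.of a := hab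
  have hk0 := Int.natAbs_ne_zero.mpr hk
  have : (b : WithZero L) = a := by
    refine h.withZero_nsmul_cancel hk0 (h.grothendieck_of_injective ?_)
    rw [map_nsmul, map_nsmul, ← hab', nsmul_add, hn, zero_add]
  rw [this] at hab'
  simpa using hab'

/-- The coefficients of a polynomial over `L` with a zero adjoined are determined by the values
at positive integers. -/
theorem eq_of_forall_sum_pow_nsmul_eq (h : AllPositiveFinite L) {N : ℕ} {w w' : ℕ → WithZero L}
    (hw : ∀ k : ℕ, ∑ i ∈ Finset.range N, (k + 1) ^ i • w i =
      ∑ i ∈ Finset.range N, (k + 1) ^ i • w' i) {i : ℕ} (hi : i < N) : w i = w' i := by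
  apply h.grothendieck_of_injective
  rw [← sub_eq_zero]
  refine eq_zero_of_forall_sum_pow_nsmul_eq_zero h.grothendieck_torsionFree
    (fun i : Fin N => Algebra.GrothendieckAddGroup.of (w i) -
      Algebra.GrothendieckAddGroup.of (w' i)) (fun k => ?_) ⟨i, hi⟩
  have := congrArg (Algebra.GrothendieckAddGroup.of) (hw k)
  rw [map_sum, map_sum, Finset.sum_range, Finset.sum_range, ← sub_eq_zero,
    ← Finset.sum_sub_distrib] at this
  rw [← this]
  exact Finset.sum_congr rfl fun i _ => by rw [map_nsmul, map_nsmul, smul_sub]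

end AllPositiveFinite

end Layers

namespace LayeredZero

variable {L G : Type*} [CommSemiringDagger L] [CommGroup G] [LinearOrder G] [IsOrderedMonoid G]

/-! ### Layers at a fixed `ν`-value. -/

section Residue

open Classical in
/-- The layer of an element if its `ν`-value is `v`, and zero otherwise. -/
noncomputable def residue (v : G) : LayeredZero L G → WithZero L :=
  WithZero.recZeroCoe 0 fun x => if x.val = v then (x.layer : WithZero L) else 0

@[simp] theorem residue_zero (v : G) : residue v (0 : LayeredZero L G) = 0 := rfl

theorem residue_coe (v : G) (x : Layered L G) [Decidable (x.val = v)] :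
    residue v (x : LayeredZero L G) = if x.val = v then (x.layer : WithZero L) else 0 := by
  unfold residue
  rw [WithZero.recZeroCoe_coe]
  congr

/-- Terms below level `v` have residue zero and layers add at level `v`. The bounds are essential: a
larger summand would erase the residue of the other. -/
theorem residue_add {v : G} {x y : LayeredZero L G} (hx : nu x ≤ v) (hy : nu y ≤ v) :
    residue v (x + y) = residue v x + residue v y := by
  cases x using WithZero.recZeroCoe with
  | zero => simp
  | coe x =>
    cases y using WithZero.recZeroCoe with
    | zero => simp
    | coe y =>
      rw [nu_coe, WithZero.coe_le_coe] at hx hy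
      rw [← WithZero.coe_add, residue_coe, residue_coe, residue_coe, Layered.add_def]
      rcases lt_trichotomy x.val y.val with h | h | h
      · simp [h, h.not_gt, (h.trans_le hy).ne]
      · simp only [h, lt_irrefl, if_false]
        split_ifs
        · rfl
        · simp
      · simp [h, (h.trans_le hx).ne]

theorem residue_sum {ι : Type*} (s : Finset ι) {v : G} {x : ι → LayeredZero L G}
    (h : ∀ i ∈ s, nu (x i) ≤ v) : residue v (∑ i ∈ s, x i) = ∑ i ∈ s, residue v (x i) := by
  classical
  induction s using Finset.induction_on with
  | empty => simp
  | insert i s his ih =>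
    have h' : ∀ j ∈ s, nu (x j) ≤ v := fun j hj => h j (by simp [hj])
    rw [Finset.sum_insert his, Finset.sum_insert his,
      residue_add (h i (by simp)) (nu_sum_le s x h'), ih h']

theorem residue_nsmul {v : G} {x : LayeredZero L G} (h : nu x ≤ v) (k : ℕ) :
    residue v (k • x) = k • residue v x := by
  simpa using residue_sum (Finset.range k) (x := fun _ => x) fun _ _ => h

theorem nu_nsmul_le (x : LayeredZero L G) (k : ℕ) : nu (k • x) ≤ nu x := by
  simpa using nu_sum_le (Finset.range k) (fun _ => x) fun _ _ => le_rfl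

theorem eq_of_residue_eq {v : G} {x y : LayeredZero L G} (h : residue v x = residue v y)
    (hx : nu x = v) : x = y := by
  classical
  cases x using WithZero.recZeroCoe with
  | zero => simp at hx
  | coe x =>
    rw [nu_coe, WithZero.coe_inj] at hx
    rw [residue_coe, if_pos hx] at h
    cases y using WithZero.recZeroCoe with
    | zero => simp at h
    | coe y =>
      rw [residue_coe] at h
      split_ifs at h with hy
      · rw [WithZero.coe_inj] at h ⊢
        exact Layered.ext h (hx.trans hy.symm)
      · simp at h

end Residue

/-! ### From both notions of decomposition to local congruence. -/

section Decomposition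

variable {f h : (LayeredZero L G)[X]}

theorem exists_forall_nu_monomial_le (f : (LayeredZero L G)[X]) (x : G) :
    ∃ i, ∀ j, nu (f.coeff j) * (x : WithZero G) ^ j ≤ nu (f.coeff i) * (x : WithZero G) ^ i := by
  obtain ⟨i, -, hi⟩ := Finset.exists_max_image (Finset.range (f.natDegree + 1))
    (fun i => nu (f.coeff i) * (x : WithZero G) ^ i) ⟨0, by simp⟩
  refine ⟨i, fun j => ?_⟩
  by_cases hj : j ≤ f.natDegree
  · exact hi j (by simpa [Nat.lt_succ_iff] using hj)
  · simp [coeff_eq_zero_of_natDegree_lt (not_le.mp hj)]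

/-- A maximal monomial of `f` at `x` is not dominated, so it also occurs in `h` and bounds `f` by
`v`. Dominated monomials then lie strictly below `v` on both sides. -/
theorem EqUpToDominated.polyCong {x v : G} (hfh : EqUpToDominated f h) (hh : PolyCong x v h h) :
    PolyCong x v f h := by
  have key : ∀ (w : WithZero G) (i : ℕ),
      w ≤ ((v * (x ^ i)⁻¹ : G) : WithZero G) ↔ w * (x : WithZero G) ^ i ≤ v := fun w i => by
    rw [WithZero.coe_mul, WithZero.coe_inv, WithZero.coe_pow, ← div_eq_mul_inv,
      le_div_iff₀ (pow_pos (WithZero.zero_lt_coe x) i)]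
  have key' : ∀ (w : WithZero G) (i : ℕ),
      w < ((v * (x ^ i)⁻¹ : G) : WithZero G) ↔ w * (x : WithZero G) ^ i < v := fun w i => by
    rw [WithZero.coe_mul, WithZero.coe_inv, WithZero.coe_pow, ← div_eq_mul_inv,
      lt_div_iff₀ (pow_pos (WithZero.zero_lt_coe x) i)]
  obtain ⟨i₀, hi₀⟩ := exists_forall_nu_monomial_le f x
  have hi₀' : f.coeff i₀ = h.coeff i₀ := (hfh i₀).resolve_right fun hd => by
    obtain ⟨j, hj⟩ := hd.1 x
    exact (hi₀ j).not_gt hj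
  have hf : ∀ j, nu (f.coeff j) * (x : WithZero G) ^ j ≤ v := fun j =>
    (hi₀ j).trans (hi₀' ▸ (key _ _).mp (hh i₀).nu_le)
  intro i
  rcases hfh i with hi | ⟨hi, hi'⟩
  · exact hi ▸ hh i
  · obtain ⟨j, hj⟩ := hi x
    obtain ⟨k, hk⟩ := hi' x
    exact Cong.of_lt ((key' _ _).mpr (hj.trans_le (hf j)))
      ((key' _ _).mpr (hk.trans_le ((key _ _).mp (hh k).nu_le)))

/-- At a point `x` at least as large as the values of all coefficients, no monomial exceeds the
leading one. This makes degrees invariant under `EqUpToDominated`. -/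
theorem NuMonic.not_strictlyDominated (hf : NuMonic f) : ¬ StrictlyDominated f f.natDegree := by
  intro hd
  obtain ⟨x, hx⟩ : ∃ x : G, ∀ i, nu (f.coeff i) ≤ x := by
    obtain ⟨i, hi⟩ := exists_forall_nu_monomial_le f 1
    simp only [WithZero.coe_one, one_pow, mul_one] at hi
    have h1 : nu (f.coeff i) ≠ 0 := fun h0 => by
      have := hi f.natDegree
      rw [h0, coeff_natDegree, show nu f.leadingCoeff = 1 from hf] at this
      simp at this
    obtain ⟨x, hx⟩ := WithZero.ne_zero_iff_exists.mp h1
    exact ⟨x, fun j => hx ▸ hi j⟩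
  have hm : nu (f.coeff f.natDegree) = 1 := hf
  have hx1 : (1 : WithZero G) ≤ x := hm ▸ hx f.natDegree
  obtain ⟨j, hj⟩ := hd x
  rw [hm, one_mul] at hj
  refine hj.not_ge ?_
  by_cases h0 : f.coeff j = 0
  · simp [h0]
  rcases (le_natDegree_of_ne_zero h0).lt_or_eq with hlt | heq
  · refine (mul_le_mul' (hx j) le_rfl).trans ?_
    rw [← pow_succ']
    exact pow_le_pow_right₀ hx1 hlt
  · rw [heq, hm, one_mul]

theorem EqUpToDominated.natDegree_le (hfh : EqUpToDominated f h) (hf : NuMonic f) :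
    f.natDegree ≤ h.natDegree := by
  have heq := (hfh f.natDegree).resolve_right fun hd => hf.not_strictlyDominated hd.1
  refine le_natDegree_of_ne_zero ?_
  rw [← heq, coeff_natDegree]
  exact leadingCoeff_ne_zero.mpr hf.ne_zero

theorem EqUpToDominated.symm (hfh : EqUpToDominated f h) : EqUpToDominated h f :=
  fun i => (hfh i).imp Eq.symm And.symm

/-- The coefficient of a monomial of `f` that is not strictly dominated is determined by the
function of `f`. -/
theorem EqAsFunctions.coeff_eq (hL : AllPositiveFinite L) (hfh : EqAsFunctions f h) (hf : f ≠ 0)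
    {x : G} {i : ℕ}
    (hi : ∀ j, nu (f.coeff j) * (x : WithZero G) ^ j ≤ nu (f.coeff i) * (x : WithZero G) ^ i) :
    f.coeff i = h.coeff i ∧
      ∀ j, nu (h.coeff j) * (x : WithZero G) ^ j ≤ nu (h.coeff i) * (x : WithZero G) ^ i := by
  -- A point of layer `1` over `x`. Replacing `y` by its multiple `k + 1` keeps the `ν`-value and
  -- multiplies the `j`-th monomial by `(k + 1) ^ j`.
  let y : LayeredZero L G := ((⟨1, x⟩ : Layered L G) : LayeredZero L G)
  have hy : nu y = x := rfl
  have hxpos : (0 : WithZero G) < x := WithZero.zero_lt_coe x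
  have hmon : ∀ (p : (LayeredZero L G)[X]) j,
      nu (p.coeff j * y ^ j) = nu (p.coeff j) * (x : WithZero G) ^ j := fun p j => by
    rw [nu_mul, nu_pow, hy]
  have hv0 : nu (f.coeff i) * (x : WithZero G) ^ i ≠ 0 := fun h0 => by
    have := hi f.natDegree
    rw [h0, le_zero_iff, mul_eq_zero, or_iff_left (pow_pos hxpos _).ne', nu_eq_zero,
      coeff_natDegree, leadingCoeff_eq_zero] at this
    exact hf this
  obtain ⟨v, hv⟩ := WithZero.ne_zero_iff_exists.mp hv0
  have hfv : ∀ j, nu (f.coeff j * y ^ j) ≤ v := fun j => by rw [hmon, hv]; exact hi j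
  set N := max (f.natDegree + 1) (h.natDegree + 1)
  have hfN : f.natDegree < N := le_max_left (f.natDegree + 1) _
  have hhN : h.natDegree < N := le_max_right _ (h.natDegree + 1)
  -- Sums never cancel, so each monomial of `h` is bounded by the common value of `h` and `f` at
  -- `y`.
  have hhv : ∀ j, nu (h.coeff j * y ^ j) ≤ v := fun j => by
    by_cases hj : j ≤ h.natDegree
    · have := nu_le_nu_sum (Finset.range N) (fun j => h.coeff j * y ^ j)
        (Finset.mem_range.mpr (hj.trans_lt hhN))
      refine this.trans ?_
      rw [← eval_eq_sum_range' hhN, ← hfh ⟨1, x⟩, eval_eq_sum_range' hfN]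
      exact nu_sum_le _ _ fun j _ => hfv j
    · simp [coeff_eq_zero_of_natDegree_lt (not_le.mp hj)]
  have hev : ∀ (p : (LayeredZero L G)[X]), p.natDegree < N → (∀ j, nu (p.coeff j * y ^ j) ≤ v) →
      ∀ k : ℕ, residue v (p.eval (((k + 1 : ℕ) : LayeredZero L G) * y)) =
        ∑ j ∈ Finset.range N, (k + 1) ^ j • residue v (p.coeff j * y ^ j) := by
    intro p hp hpv k
    have : p.eval (((k + 1 : ℕ) : LayeredZero L G) * y) =
        ∑ j ∈ Finset.range N, (k + 1) ^ j • (p.coeff j * y ^ j) := by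
      rw [eval_eq_sum_range' hp]
      refine Finset.sum_congr rfl fun j _ => ?_
      rw [nsmul_eq_mul, mul_pow, Nat.cast_pow, mul_left_comm]
    rw [this, residue_sum _ fun j _ => (nu_nsmul_le _ _).trans (hpv j)]
    exact Finset.sum_congr rfl fun j _ => residue_nsmul (hpv j) _
  have hres : residue v (f.coeff i * y ^ i) = residue v (h.coeff i * y ^ i) := by
    have hiN : i < N := lt_of_le_of_lt (le_natDegree_of_ne_zero fun h0 => hv0 (by simp [h0])) hfN
    refine hL.eq_of_forall_sum_pow_nsmul_eq
      (w := fun i => residue v (f.coeff i * y ^ i)) (w' := fun i => residue v (h.coeff i * y ^ i))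
      (fun k => ?_) hiN
    have hk : ((k + 1 : ℕ) : LayeredZero L G) * y ≠ 0 := by
      rw [Ne, ← nu_eq_zero, nu_mul, hy, Nat.cast_succ, nu_add, nu_one]
      exact (mul_pos (lt_max_of_lt_right zero_lt_one) hxpos).ne'
    obtain ⟨z, hz⟩ := WithZero.ne_zero_iff_exists.mp hk
    rw [← hev f hfN hfv, ← hev h hhN hhv, ← hz, hfh z]
  have heq := eq_of_residue_eq hres (by rw [hmon, hv])
  -- Layer `1` makes `y` invertible, so the equality of monomials passes to the coefficients.
  have hunit : y ^ i * ((⟨1, x⁻¹⟩ : Layered L G) : LayeredZero L G) ^ i = 1 := by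
    rw [← mul_pow, ← WithZero.coe_mul, Layered.mul_def]
    simp [← Layered.one_def]
  have hcoeff : f.coeff i = h.coeff i := by
    rw [← mul_one (f.coeff i), ← hunit, ← mul_assoc, heq, mul_assoc, hunit, mul_one]
  exact ⟨hcoeff, fun j => by rw [← hmon, ← hcoeff, ← hv]; exact hhv j⟩

theorem EqAsFunctions.eqUpToDominated (hL : AllPositiveFinite L) (hfh : EqAsFunctions f h)
    (hf : f ≠ 0) (hh : h ≠ 0) : EqUpToDominated f h := by
  have hdom : ∀ {p : (LayeredZero L G)[X]} {i}, ¬ StrictlyDominated p i → ∃ x : G, ∀ j,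
      nu (p.coeff j) * (x : WithZero G) ^ j ≤ nu (p.coeff i) * (x : WithZero G) ^ i := by
    intro p i hp
    simpa [StrictlyDominated] using hp
  intro i
  by_cases h₁ : StrictlyDominated f i
  · by_cases h₂ : StrictlyDominated h i
    · exact Or.inr ⟨h₁, h₂⟩
    · obtain ⟨x, hx⟩ := hdom h₂
      exact Or.inl (EqAsFunctions.coeff_eq hL (fun x => (hfh x).symm) hh hx).1.symm
  · obtain ⟨x, hx⟩ := hdom h₁
    exact Or.inl (hfh.coeff_eq hL hf hx).1

theorem IsPrimaryDecomposition.eqUpToDominated {A : Finset G} {fa : G → (LayeredZero L G)[X]}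
    (hA : IsPrimaryDecomposition f A fa) (hf : NuMonic f) :
    EqUpToDominated f (∏ a ∈ A, fa a) := by
  rcases hA.eq_prod with h | ⟨hL, h⟩
  · exact h
  · exact h.eqUpToDominated hL hf.ne_zero (NuMonic.prod fun a ha => (hA.primary a ha).monic).ne_zero

end Decomposition

/-! ### Resultants of primary polynomials and assembly. -/

section Main

theorem layeredResultant_one_right (f : (LayeredZero L G)[X]) : layeredResultant f 1 = 1 := by
  unfold layeredResultant
  rw [natDegree_one]
  refine Eq.trans (congrArg _ ?_) Matrix.permanent_one
  ext r c
  simp [sylvesterMatrix_apply, coeff_X_pow, Matrix.one_apply, Fin.ext_iff, eq_comm]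

theorem layeredResultant_one_left (g : (LayeredZero L G)[X]) : layeredResultant 1 g = 1 := by
  unfold layeredResultant
  rw [natDegree_one]
  refine Eq.trans (congrArg _ ?_) Matrix.permanent_one
  ext r c
  have hr : (r : ℕ) < g.natDegree := by simpa using r.2
  simp [sylvesterMatrix_apply, coeff_X_pow, Matrix.one_apply, Fin.ext_iff, eq_comm, hr]

variable {S : Finset G} {F K : G → (LayeredZero L G)[X]} {f g : (LayeredZero L G)[X]} {a b : G}

theorem polyCong_of_eqUpToDominated (hF : ∀ a ∈ S, IsPrimary a (F a))
    (hf : EqUpToDominated f (∏ a ∈ S, F a)) :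
    ∀ a ∈ S, PolyCong a (growth S (fun a => (F a).natDegree) a) f (∏ a ∈ S, F a) :=
  fun _ ha => hf.polyCong ((polyCong_prod hF ha).trans (polyCong_prod hF ha).symm)

/-- The product formula over `{a, b}`, with `1` as the missing factor at each root: both remaining
resultants involve `1` and are trivial, so only cofactors survive. -/
theorem layeredResultant_primary (hf : IsPrimary a f) (hg : IsPrimary b g) :
    (a < b → layeredResultant f g = f.leadingCoeff ^ g.natDegree * g.coeff 0 ^ f.natDegree) ∧
    (b < a → layeredResultant f g = f.coeff 0 ^ g.natDegree * g.leadingCoeff ^ f.natDegree) := by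
  by_cases hab : a = b
  · subst hab
    exact ⟨fun h => absurd h (lt_irrefl _), fun h => absurd h (lt_irrefl _)⟩
  classical
  let F : G → (LayeredZero L G)[X] := fun x => if x = a then f else 1
  let K : G → (LayeredZero L G)[X] := fun x => if x = b then g else 1
  have hF : ∀ x ∈ ({a, b} : Finset G), IsPrimary x (F x) := fun x _ => by
    simp only [F]
    split_ifs with h
    · exact h ▸ hf
    · exact IsPrimary.one x
  have hK : ∀ x ∈ ({a, b} : Finset G), IsPrimary x (K x) := fun x _ => by
    simp only [K]
    split_ifs with h
    · exact h ▸ hg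
    · exact IsPrimary.one x
  have hf' : ∏ x ∈ ({a, b} : Finset G), F x = f := by
    rw [Finset.prod_pair hab]
    simp [F, Ne.symm hab]
  have hg' : ∏ x ∈ ({a, b} : Finset G), K x = g := by
    rw [Finset.prod_pair hab]
    simp [K, hab]
  have key := layeredResultant_eq_prod hF hK
    (polyCong_of_eqUpToDominated (f := f) hF fun i => Or.inl (by rw [hf']))
    (polyCong_of_eqUpToDominated (f := g) hK fun i => Or.inl (by rw [hg']))
    (by rw [← natDegree_prod_of_primary hF, hf']) (by rw [← natDegree_prod_of_primary hK, hg'])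
  rw [Finset.prod_pair hab, cofactor, cofactor, cofactor, cofactor, Finset.prod_pair hab,
    Finset.prod_pair hab, Finset.prod_pair hab, Finset.prod_pair hab] at key
  simp only [F, K, if_true, if_neg hab, if_neg (Ne.symm hab), lt_irrefl, if_false,
    layeredResultant_one_left, layeredResultant_one_right, natDegree_one, pow_zero, one_mul,
    mul_one] at key
  refine ⟨fun h => ?_, fun h => ?_⟩
  · rw [key, if_neg h.not_gt, if_pos h, if_pos h, mul_comm]
  · rw [key, if_pos h, if_neg h.not_gt, if_pos h, mul_comm]

theorem layeredResultant_eq_prod_prod (hF : ∀ a ∈ S, IsPrimary a (F a))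
    (hK : ∀ a ∈ S, IsPrimary a (K a)) (hf : NuMonic f) (hg : NuMonic g)
    (hfF : EqUpToDominated f (∏ a ∈ S, F a)) (hgK : EqUpToDominated g (∏ a ∈ S, K a)) :
    layeredResultant f g = ∏ a ∈ S, ∏ b ∈ S, layeredResultant (F a) (K b) := by
  have hdeg : ∀ {f : (LayeredZero L G)[X]} {F : G → (LayeredZero L G)[X]}, NuMonic f →
      (∀ a ∈ S, IsPrimary a (F a)) → EqUpToDominated f (∏ a ∈ S, F a) →
      f.natDegree = ∑ a ∈ S, (F a).natDegree := fun {f F} hf hF hfF => by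
    rw [← natDegree_prod_of_primary hF]
    exact le_antisymm (hfF.natDegree_le hf)
      (hfF.symm.natDegree_le (NuMonic.prod fun a ha => (hF a ha).monic))
  rw [layeredResultant_eq_prod hF hK (polyCong_of_eqUpToDominated hF hfF)
    (polyCong_of_eqUpToDominated hK hgK) (hdeg hf hF hfF) (hdeg hg hK hgK)]
  have hpair : ∀ a ∈ S, ∀ b ∈ S, layeredResultant (F a) (K b) =
      (if a < b then (F a).leadingCoeff else if b < a then (F a).coeff 0 else 1) ^
          (K b).natDegree *
        (if b < a then (K b).leadingCoeff else if a < b then (K b).coeff 0 else 1) ^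
          (F a).natDegree *
        if a = b then layeredResultant (F a) (K a) else 1 := by
    intro a ha b hb
    have := layeredResultant_primary (hF a ha) (hK b hb)
    rcases lt_trichotomy a b with h | rfl | h
    · simp [h, h.ne, h.not_gt, this.1 h]
    · simp
    · simp [h, h.ne', h.not_gt, this.2 h]
  rw [Finset.prod_congr rfl fun a ha => Finset.prod_congr rfl fun b hb => hpair a ha b hb]
  simp only [Finset.prod_mul_distrib]
  -- Cofactors of `F` are indexed by the root of the other polynomial, so this half of the double
  -- product must be transposed.
  rw [Finset.prod_comm (f := fun a b => (if a < b then (F a).leadingCoeff else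
    if b < a then (F a).coeff 0 else 1) ^ (K b).natDegree)]
  simp only [cofactor, Finset.prod_pow]
  congr 1
  exact Finset.prod_congr rfl fun a ha => by rw [Finset.prod_ite_eq, if_pos ha]

end Main

end LayeredZero

theorem mainTheorem2 {L G : Type*} [CommSemiringDagger L]
    [CommGroup G] [LinearOrder G] [IsOrderedMonoid G]
    (f g : Polynomial (LayeredZero L G))
    (hf : LayeredZero.NuMonic f) (hg : LayeredZero.NuMonic g)
    (A B : Finset G) (fa gb : G → Polynomial (LayeredZero L G))
    (hfa : LayeredZero.IsPrimaryDecomposition f A fa)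
    (hgb : LayeredZero.IsPrimaryDecomposition g B gb) :
    LayeredZero.layeredResultant f g =
        ∏ a ∈ A, ∏ b ∈ B, LayeredZero.layeredResultant (fa a) (gb b) ∧
      ∀ a ∈ A, ∀ b ∈ B,
        (a < b → LayeredZero.layeredResultant (fa a) (gb b) =
          (fa a).leadingCoeff ^ (gb b).natDegree * (gb b).coeff 0 ^ (fa a).natDegree) ∧
        (b < a → LayeredZero.layeredResultant (fa a) (gb b) =
          (fa a).coeff 0 ^ (gb b).natDegree * (gb b).leadingCoeff ^ (fa a).natDegree) := by
  classical
  -- Since `1` is primary for every root, both decompositions can be padded to the common index set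
  -- `A ∪ B`; the padding later contributes trivial resultants.
  have extend : ∀ {f : Polynomial (LayeredZero L G)} {A T : Finset G}
      {fa : G → Polynomial (LayeredZero L G)}, A ⊆ T → LayeredZero.NuMonic f →
      LayeredZero.IsPrimaryDecomposition f A fa →
      (∀ a ∈ T, LayeredZero.IsPrimary a (if a ∈ A then fa a else 1)) ∧
        LayeredZero.EqUpToDominated f (∏ a ∈ T, if a ∈ A then fa a else 1) := by
    intro f A T fa hAT hf hfa
    refine ⟨fun a _ => ?_, ?_⟩
    · split_ifs with ha
      · exact hfa.primary a ha
      · exact LayeredZero.IsPrimary.one a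
    · rw [Finset.prod_ite_mem, Finset.inter_eq_right.mpr hAT]
      exact hfa.eqUpToDominated hf
  obtain ⟨hF, hf'⟩ := extend (T := A ∪ B) Finset.subset_union_left hf hfa
  obtain ⟨hK, hg'⟩ := extend (T := A ∪ B) Finset.subset_union_right hg hgb
  refine ⟨?_, fun a ha b hb =>
    LayeredZero.layeredResultant_primary (hfa.primary a ha) (hgb.primary b hb)⟩
  rw [LayeredZero.layeredResultant_eq_prod_prod hF hK hf hg hf' hg']
  have hsplit : ∀ a b, LayeredZero.layeredResultant (if a ∈ A then fa a else 1)
      (if b ∈ B then gb b else 1) =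
      if a ∈ A then if b ∈ B then LayeredZero.layeredResultant (fa a) (gb b) else 1 else 1 := by
    intro a b
    split_ifs <;>
      simp [LayeredZero.layeredResultant_one_left, LayeredZero.layeredResultant_one_right]
  simp only [hsplit]
  have houter : ∀ a, (∏ b ∈ A ∪ B, if a ∈ A then if b ∈ B then
      LayeredZero.layeredResultant (fa a) (gb b) else 1 else 1) =
      if a ∈ A then ∏ b ∈ B, LayeredZero.layeredResultant (fa a) (gb b) else 1 := by
    intro a
    split_ifs
    · rw [Finset.prod_ite_mem, Finset.inter_eq_right.mpr Finset.subset_union_right]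
    · exact Finset.prod_const_one
  simp only [houter]
  rw [Finset.prod_ite_mem, Finset.inter_eq_right.mpr Finset.subset_union_left]
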